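/- Cut the oriented sphere along a circle into two discs, and mark four points on the circle. For positive integers $p,q$ let the *double twist diagram* $D(p,q)$ be the following link diagram on the sphere. The first disc contains two strands which run alongside an edge $e$ joining two opposite of the four boundary arcs and which cross each other $p$ times (a row of $p$ half twists along $e$). The second disc contains two strands which run alongside an edge $e'$ joining the other two boundary arcs and which cross each other $q$ times (a row of $q$ half twists along $e'$). The strands are joined at the four marked points. All crossings are positive with respect to their edge: if the edge, with the orientation of the sphere, is followed in either direction, the under-strand passes from the left of the edge to the right, and the over-strand from the right to the left. (Thus the two rows are twisted in the same way relative to their own edges, and $D(p,q)$ is non-alternating.) If $p$ and $q$ are even, $D(p,q)$ is a knot diagram; let $K(p,q)$ denote the knot that it represents. Two knot diagrams on the oriented sphere represent the same (unoriented) knot if they are related by a finite sequence of Reidemeister moves and orientation-preserving homeomorphisms of the sphere, that is, if the knots in $S^3$ that they represent are ambient isotopic. **Theorem.** Let $p,q,a,b$ be even positive integers. Then $K(p,q)=K(a,b)$ if and only if $\{p,q\}=\{a,b\}$. -/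

import Mathlib

namespace KnotDiag

/-!
# Knots as planar diagrams up to Reidemeister moves

A diagram on the oriented sphere is written as a planar diagram code. The arcs carry names
(natural numbers), and the code is the multiset of the vertices of the diagram, each vertex listing
the arcs that leave it in counterclockwise order. Besides crossings there are marked points
subdividing arcs, so that gluing pieces of diagrams, and the circle without crossings, need no
separate treatment.
-/

/-- A vertex of a diagram.
* `cross a b c d`: a crossing which the arcs `a`, `b`, `c`, `d` leave in counterclockwise order;
  the strand through `a` and `c` passes under the strand through `b` and `d`.
* `pt a b`: a marked point, at which the arc `a` continues as the arc `b`. -/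
inductive Node : Type
  | cross (a b c d : ℕ) : Node
  | pt (a b : ℕ) : Node

/-- The ends of arcs at a vertex. -/
def Node.arcs : Node → Multiset ℕ
  | .cross a b c d => {a, b, c, d}
  | .pt a b => {a, b}

/-- Renaming of the arcs. -/
def Node.relabel (f : ℕ → ℕ) : Node → Node
  | .cross a b c d => .cross (f a) (f b) (f c) (f d)
  | .pt a b => .pt (f a) (f b)

/-- The number of crossings (1 or 0) at a vertex. -/
def Node.crossings : Node → ℕ
  | .cross _ _ _ _ => 1
  | .pt _ _ => 0

/-- A planar diagram code. -/
abbrev Code : Type := Multiset Node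

/-- The ends of arcs at all vertices of the code. -/
def Code.arcs (D : Code) : Multiset ℕ := D.bind Node.arcs

/-- The number of crossings of the code. -/
def Code.crossings (D : Code) : ℕ := (D.map Node.crossings).sum

/-- Every arc has exactly two ends. -/
def Code.ArcsTwice (D : Code) : Prop := ∀ a ∈ D.arcs, D.arcs.count a = 2

/-- The arc `x` is continued, at some vertex, by the arc `y`. -/
def Code.Strand (D : Code) (x y : ℕ) : Prop :=
  (∃ b d, Node.cross x b y d ∈ D) ∨ (∃ a c, Node.cross a x c y ∈ D) ∨ Node.pt x y ∈ D

/-- The diagram has one component: following the strands one gets from any arc to any other. -/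
def Code.OneComponent (D : Code) : Prop :=
  ∀ x ∈ D.arcs, ∀ y ∈ D.arcs, Relation.EqvGen D.Strand x y

/-- A vertex together with names of the regions that meet it: at `cross a b c d ab bc cd da` the
region `ab` lies between the consecutive arcs `a` and `b`, and so on; at `pt a b l r` the region `l`
is on the left and `r` on the right when one passes from `a` to `b`. -/
inductive RegionNode : Type
  | cross (a b c d ab bc cd da : ℕ) : RegionNode
  | pt (a b l r : ℕ) : RegionNode

/-- Forget the regions. -/
def RegionNode.toNode : RegionNode → Node
  | .cross a b c d _ _ _ _ => .cross a b c d
  | .pt a b _ _ => .pt a b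

/-- The ends of arcs at a vertex, each with the regions on the left and on the right of the arc as
seen when one leaves the vertex along it. -/
def RegionNode.ends : RegionNode → Multiset (ℕ × ℕ × ℕ)
  | .cross a b c d ab bc cd da => {(a, ab, da), (b, bc, ab), (c, cd, bc), (d, da, cd)}
  | .pt a b l r => {(a, r, l), (b, l, r)}

/-- The same arc with the same two regions next to it, seen from its other end. -/
def flipEnd (t : ℕ × ℕ × ℕ) : ℕ × ℕ × ℕ := (t.1, t.2.2, t.2.1)

/-- The code of a connected diagram is planar: the regions around the vertices can be named so that
the two ends of each arc see the same two regions, on opposite sides (`T` lists every arc once, seen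
from one of its ends), and there are `crossings + 2` different regions. By Euler's formula a
connected diagram with `n` crossings on a closed oriented surface of genus `g`, whose complement
consists of discs, has `n + 2 - 2 * g` regions, so this says that the surface is the sphere. -/
def Code.Planar (D : Code) : Prop :=
  ∃ (E : Multiset RegionNode) (T : Multiset (ℕ × ℕ × ℕ)),
    E.map RegionNode.toNode = D ∧
    E.bind RegionNode.ends = T + T.map flipEnd ∧
    (T.map (fun t => t.2.1) + T.map (fun t => t.2.2)).toFinset.card = D.crossings + 2

/-- A knot diagram on the oriented sphere. -/
structure KnotDiagram : Type where
  code : Code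
  arcsTwice : code.ArcsTwice
  oneComponent : code.OneComponent
  planar : code.Planar

/-- Two notations for the same vertex. -/
inductive Node.Same : Node → Node → Prop
  | refl (v : Node) : Node.Same v v
  | rotate (a b c d : ℕ) : Node.Same (.cross a b c d) (.cross c d a b)
  | swap (a b : ℕ) : Node.Same (.pt a b) (.pt b a)

/-- Elementary moves between codes: change of notation, removal of a marked point, and the
Reidemeister moves. They are used in both directions, and between codes of knot diagrams only. -/
inductive Move : Code → Code → Prop
  /-- The same diagram, with other names for the arcs and possibly another notation for each
  vertex. -/
  | rename (σ : Equiv.Perm ℕ) {D D' : Code}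
      (h : Multiset.Rel Node.Same (D.map (Node.relabel σ)) D') : Move D D'
  /-- The marked point between the different arcs `a` and `b` is removed, and the united arc is
  called `a`. -/
  | unmark {a b : ℕ} (h : a ≠ b) (R : Code) :
      Move (Node.pt a b ::ₘ R) (R.map (Node.relabel fun x => if x = b then a else x))
  /-- First Reidemeister move: removal of a curl (of one sign). -/
  | reidemeister1 (a b c : ℕ) (R : Code) :
      Move (Node.cross a b b c ::ₘ R) (Node.pt a c ::ₘ R)
  /-- First Reidemeister move: removal of a curl (of the other sign). -/
  | reidemeister1' (a b c : ℕ) (R : Code) :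
      Move (Node.cross b b a c ::ₘ R) (Node.pt a c ::ₘ R)
  /-- Second Reidemeister move: the strand `b f d` passes over the strand `a e c` twice, and `e`,
  `f` bound a bigon. -/
  | reidemeister2 (a b c d e f : ℕ) (R : Code) :
      Move ({Node.cross a f e b, Node.cross e f c d} + R) ({Node.pt a c, Node.pt b d} + R)
  /-- Third Reidemeister move. The ends `e₁, …, e₆` lie in counterclockwise order around a disc; the
  strand `e₁ x e₄` is at the bottom, `e₂ y e₅` in the middle and `e₃ z e₆` on top. -/
  | reidemeister3 (e₁ e₂ e₃ e₄ e₅ e₆ x y z : ℕ) (R : Code) :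
      Move ({Node.cross e₁ e₂ x y, Node.cross e₄ z x e₃, Node.cross e₅ e₆ y z} + R)
        ({Node.cross e₄ e₅ x y, Node.cross e₁ z x e₆, Node.cross e₂ e₃ y z} + R)
  /-- Third Reidemeister move, with `e₁ x e₄` at the bottom, `e₃ z e₆` in the middle and `e₂ y e₅`
  on top. -/
  | reidemeister3' (e₁ e₂ e₃ e₄ e₅ e₆ x y z : ℕ) (R : Code) :
      Move ({Node.cross e₁ e₂ x y, Node.cross e₄ z x e₃, Node.cross e₆ y z e₅} + R)
        ({Node.cross e₄ e₅ x y, Node.cross e₁ z x e₆, Node.cross e₃ y z e₂} + R)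

/-- A (classical, unoriented) knot: a knot diagram on the sphere up to the equivalence relation
generated by the moves. All intermediate diagrams are planar knot diagrams. -/
def Knot : Type := Quot fun D D' : KnotDiagram => Move D.code D'.code

/-- `n` positive half twists along an edge. Two strands run along the edge; between the crossings
number `i - 1` and `i` the left one is the arc `l i` and the right one is the arc `r i`. -/
def twists (l r : ℕ → ℕ) (n : ℕ) : Code :=
  (Multiset.range n).map fun i => Node.cross (l i) (r i) (r (i + 1)) (l (i + 1))

/-- The double twist diagram. The sphere is the union of two discs, with `p` positive half twists
along the edge of the tree in the first disc and `q` along the edge of the tree in the second. The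
four points on the common boundary circle are, in cyclic order, the beginnings of the first edge's
left strand and right strand and the ends of its right strand and left strand (north-west,
south-west, south-east, north-east if the first edge runs from west to east); the second edge
starts between the two left points (north) and ends between the two right points (south). -/
def doubleTwistCode (p q : ℕ) : Code :=
  twists (fun i => 4 * i) (fun i => 4 * i + 1) p +
  twists (fun j => 4 * j + 2) (fun j => 4 * j + 3) q +
  {Node.pt (4 * 0) (4 * 0 + 2), Node.pt (4 * p) (4 * 0 + 3),
   Node.pt (4 * 0 + 1) (4 * q + 2), Node.pt (4 * p + 1) (4 * q + 3)}

theorem range_telescope {α : Type} (x y x' y' : ℕ → α) (n : ℕ) :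
    ((Multiset.range n).bind fun i => ({x i, y i, y' (i + 1), x' (i + 1)} : Multiset α)) +
        {x' 0, y' 0, x n, y n} =
      (Multiset.range (n + 1)).bind fun i => ({x i, x' i, y i, y' i} : Multiset α) := by
  induction n with
  | zero =>
    simp only [Multiset.range_succ, Multiset.range_zero, Multiset.insert_eq_cons,
      ← Multiset.singleton_add, Multiset.add_bind, Multiset.singleton_bind, Multiset.zero_bind]
    abel
  | succ n ih =>
    rw [Multiset.range_succ (n := n + 1), Multiset.cons_bind, ← ih, Multiset.range_succ,
      Multiset.cons_bind]
    simp only [Multiset.insert_eq_cons, ← Multiset.singleton_add]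
    abel

/-- The vertices of a twist region with names of the regions: `m i` between the crossings number
`i - 1` and `i`, `L` on the left and `R` on the right of the edge. -/
def twistsR (l r m : ℕ → ℕ) (L R n : ℕ) : Multiset RegionNode :=
  (Multiset.range n).map fun i =>
    RegionNode.cross (l i) (r i) (r (i + 1)) (l (i + 1)) (m i) R (m (i + 1)) L

theorem twistsR_toNode (l r m : ℕ → ℕ) (L R n : ℕ) :
    (twistsR l r m L R n).map RegionNode.toNode = twists l r n := by
  rw [twistsR, twists, Multiset.map_map]
  rfl

/-- The arcs of a twist region. -/
def twistsT (l r m : ℕ → ℕ) (L R n : ℕ) : Multiset (ℕ × ℕ × ℕ) :=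
  (Multiset.range (n + 1)).map (fun i => (l i, L, m i)) +
  (Multiset.range (n + 1)).map (fun i => (r i, m i, R))

theorem twistsR_ends (l r m : ℕ → ℕ) (L R n : ℕ) :
    (twistsR l r m L R n).bind RegionNode.ends +
        {(l 0, L, m 0), (r 0, m 0, R), (l n, m n, L), (r n, R, m n)} =
      twistsT l r m L R n + (twistsT l r m L R n).map flipEnd := by
  have h := range_telescope (fun i => (l i, m i, L)) (fun i => (r i, R, m i))
    (fun i => (l i, L, m i)) (fun i => (r i, m i, R)) n
  have e : (twistsR l r m L R n).bind RegionNode.ends =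
      (Multiset.range n).bind fun i =>
        ({(l i, m i, L), (r i, R, m i), (r (i + 1), m (i + 1), R), (l (i + 1), L, m (i + 1))} :
          Multiset (ℕ × ℕ × ℕ)) := by
    simp [twistsR, Multiset.bind_map, RegionNode.ends]
  rw [e, h]
  simp only [twistsT, Multiset.map_add, Multiset.map_map, flipEnd, Function.comp_def]
  simp only [Multiset.insert_eq_cons, ← Multiset.singleton_add, Multiset.bind_add,
    Multiset.bind_singleton]
  abel

/-- The arcs of the double twist diagram, with the regions next to them. -/
def doubleTwistT (p q : ℕ) : Multiset (ℕ × ℕ × ℕ) :=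
  twistsT (fun i => 4 * i) (fun i => 4 * i + 1) (fun i => 2 * i) 1 (2 * q + 1) p +
  twistsT (fun j => 4 * j + 2) (fun j => 4 * j + 3) (fun j => 2 * j + 1) 0 (2 * p) q

/-- The double twist diagram with names of the regions. -/
def doubleTwistR (p q : ℕ) : Multiset RegionNode :=
  twistsR (fun i => 4 * i) (fun i => 4 * i + 1) (fun i => 2 * i) 1 (2 * q + 1) p +
  twistsR (fun j => 4 * j + 2) (fun j => 4 * j + 3) (fun j => 2 * j + 1) 0 (2 * p) q +
  {RegionNode.pt (4 * 0) (4 * 0 + 2) 0 1, RegionNode.pt (4 * p) (4 * 0 + 3) 1 (2 * p),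
   RegionNode.pt (4 * 0 + 1) (4 * q + 2) (2 * q + 1) 0,
   RegionNode.pt (4 * p + 1) (4 * q + 3) (2 * p) (2 * q + 1)}

theorem doubleTwistR_toNode (p q : ℕ) :
    (doubleTwistR p q).map RegionNode.toNode = doubleTwistCode p q := by
  simp [doubleTwistR, doubleTwistCode, twistsR_toNode, RegionNode.toNode]

theorem doubleTwistR_ends (p q : ℕ) :
    (doubleTwistR p q).bind RegionNode.ends =
      doubleTwistT p q + (doubleTwistT p q).map flipEnd := by
  have h₁ := twistsR_ends (fun i => 4 * i) (fun i => 4 * i + 1) (fun i => 2 * i) 1 (2 * q + 1) p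
  have h₂ := twistsR_ends (fun j => 4 * j + 2) (fun j => 4 * j + 3) (fun j => 2 * j + 1) 0 (2 * p) q
  have e : doubleTwistT p q + (doubleTwistT p q).map flipEnd =
      (twistsT (fun i => 4 * i) (fun i => 4 * i + 1) (fun i => 2 * i) 1 (2 * q + 1) p +
        (twistsT (fun i => 4 * i) (fun i => 4 * i + 1) (fun i => 2 * i) 1 (2 * q + 1) p).map
          flipEnd) +
      (twistsT (fun j => 4 * j + 2) (fun j => 4 * j + 3) (fun j => 2 * j + 1) 0 (2 * p) q +
        (twistsT (fun j => 4 * j + 2) (fun j => 4 * j + 3) (fun j => 2 * j + 1) 0 (2 * p) q).map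
          flipEnd) := by
    simp only [doubleTwistT, Multiset.map_add]
    abel
  rw [e, ← h₁, ← h₂]
  simp only [doubleTwistR, Multiset.add_bind, Multiset.insert_eq_cons, ← Multiset.singleton_add,
    Multiset.singleton_bind, RegionNode.ends, mul_zero, zero_add]
  abel

theorem doubleTwist_arcs (p q : ℕ) : (doubleTwistCode p q).arcs =
    (doubleTwistT p q).map Prod.fst + (doubleTwistT p q).map Prod.fst := by
  have h := congrArg (Multiset.map Prod.fst) (doubleTwistR_ends p q)
  rw [Multiset.map_add, Multiset.map_map, Multiset.map_bind] at h
  have e : ∀ v : RegionNode, v.ends.map Prod.fst = v.toNode.arcs := by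
    rintro (_ | _) <;> simp [RegionNode.ends, RegionNode.toNode, Node.arcs]
  simp only [e] at h
  rw [Code.arcs, ← doubleTwistR_toNode, Multiset.bind_map, h]
  rfl

theorem doubleTwistT_nodup (p q : ℕ) : ((doubleTwistT p q).map Prod.fst).Nodup := by
  simp only [doubleTwistT, twistsT, Multiset.map_add, Multiset.map_map, Function.comp_def]
  have key : ∀ k n : ℕ, ((Multiset.range n).map fun i => 4 * i + k).Nodup := fun k n =>
    (Multiset.nodup_range n).map (fun i j h => by simpa using h)
  have key0 : ∀ n : ℕ, ((Multiset.range n).map fun i => 4 * i).Nodup := fun n => key 0 n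
  simp only [Multiset.nodup_add, key, key0, true_and, Multiset.disjoint_left, Multiset.mem_add,
    Multiset.mem_map]
  refine ⟨?_, ?_, ?_⟩
  · rintro _ ⟨i, -, rfl⟩ ⟨j, -, h⟩
    omega
  · rintro _ ⟨i, -, rfl⟩ ⟨j, -, h⟩
    omega
  · rintro _ (⟨i, -, rfl⟩ | ⟨i, -, rfl⟩) (⟨j, -, h⟩ | ⟨j, -, h⟩) <;> omega

theorem doubleTwist_arcsTwice (p q : ℕ) : (doubleTwistCode p q).ArcsTwice := by
  intro a ha
  rw [doubleTwist_arcs] at ha ⊢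
  have h := Multiset.count_eq_one_of_mem (doubleTwistT_nodup p q) (a := a) (by simpa using ha)
  rw [Multiset.count_add, h]

theorem doubleTwist_crossings (p q : ℕ) : (doubleTwistCode p q).crossings = p + q := by
  simp [doubleTwistCode, Code.crossings, twists, Node.crossings, Multiset.map_map,
    Function.comp_def]

theorem doubleTwist_planar (p q : ℕ) : (doubleTwistCode p q).Planar := by
  refine ⟨doubleTwistR p q, doubleTwistT p q, doubleTwistR_toNode p q, doubleTwistR_ends p q, ?_⟩
  rw [doubleTwist_crossings]
  have e : ((doubleTwistT p q).map (fun t => t.2.1) +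
      (doubleTwistT p q).map (fun t => t.2.2)).toFinset =
      (Finset.range (p + 1)).image (fun i => 2 * i) ∪
        (Finset.range (q + 1)).image (fun i => 2 * i + 1) := by
    ext x
    simp only [doubleTwistT, twistsT, Multiset.map_add, Multiset.map_map, Function.comp_def,
      Multiset.mem_toFinset, Multiset.mem_add, Multiset.mem_map, Multiset.mem_range,
      Finset.mem_union, Finset.mem_image, Finset.mem_range]
    constructor
    · rintro (((⟨i, hi, rfl⟩ | ⟨i, hi, rfl⟩) | (⟨i, hi, rfl⟩ | ⟨i, hi, rfl⟩)) |
        ((⟨i, hi, rfl⟩ | ⟨i, hi, rfl⟩) | (⟨i, hi, rfl⟩ | ⟨i, hi, rfl⟩)))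
      · exact Or.inr ⟨0, by omega, rfl⟩
      · exact Or.inl ⟨i, hi, rfl⟩
      · exact Or.inl ⟨0, by omega, rfl⟩
      · exact Or.inr ⟨i, hi, rfl⟩
      · exact Or.inl ⟨i, hi, rfl⟩
      · exact Or.inr ⟨q, by omega, rfl⟩
      · exact Or.inr ⟨i, hi, rfl⟩
      · exact Or.inl ⟨p, by omega, rfl⟩
    · rintro (⟨i, hi, rfl⟩ | ⟨i, hi, rfl⟩)
      · exact Or.inl (Or.inl (Or.inr ⟨i, hi, rfl⟩))
      · exact Or.inl (Or.inr (Or.inr ⟨i, hi, rfl⟩))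
  rw [e, Finset.card_union_of_disjoint, Finset.card_image_of_injective,
    Finset.card_image_of_injective, Finset.card_range, Finset.card_range]
  · omega
  · intro i j h
    simpa using h
  · intro i j h
    simpa using h
  · rw [Finset.disjoint_left]
    simp only [Finset.mem_image]
    rintro _ ⟨i, -, rfl⟩ ⟨j, -, h⟩
    omega

/-- In a twist region with an even number of crossings both strands run from one end to the other
on the same side, and they contain all its arcs. -/
theorem twists_strand (D : Code) (l r : ℕ → ℕ) (n : ℕ) (h : twists l r n ≤ D) :
    ∀ i ≤ n, if Even i
      then Relation.EqvGen D.Strand (l 0) (l i) ∧ Relation.EqvGen D.Strand (r 0) (r i)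
      else Relation.EqvGen D.Strand (l 0) (r i) ∧ Relation.EqvGen D.Strand (r 0) (l i) := by
  have step : ∀ i < n, D.Strand (l i) (r (i + 1)) ∧ D.Strand (r i) (l (i + 1)) := by
    intro i hi
    have hm : Node.cross (l i) (r i) (r (i + 1)) (l (i + 1)) ∈ D :=
      Multiset.mem_of_le h (Multiset.mem_map.2 ⟨i, Multiset.mem_range.2 hi, rfl⟩)
    exact ⟨Or.inl ⟨_, _, hm⟩, Or.inr (Or.inl ⟨_, _, hm⟩)⟩
  intro i
  induction i with
  | zero => intro _; simpa using ⟨Relation.EqvGen.refl _, Relation.EqvGen.refl _⟩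
  | succ i ih =>
    intro hi
    have h₁ := ih (by omega)
    obtain ⟨s, t⟩ := step i (by omega)
    by_cases he : Even i
    · rw [if_pos he] at h₁
      rw [if_neg (by simpa [Nat.even_add_one] using he)]
      exact ⟨h₁.1.trans _ _ _ (.rel _ _ s), h₁.2.trans _ _ _ (.rel _ _ t)⟩
    · rw [if_neg he] at h₁
      rw [if_pos (by simpa [Nat.even_add_one] using he)]
      exact ⟨h₁.1.trans _ _ _ (.rel _ _ t), h₁.2.trans _ _ _ (.rel _ _ s)⟩

theorem doubleTwist_oneComponent (p q : ℕ) (hp : Even p) (hq : Even q) :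
    (doubleTwistCode p q).OneComponent := by
  set D := doubleTwistCode p q with hD
  have hA := twists_strand D (fun i => 4 * i) (fun i => 4 * i + 1) p (by
    rw [hD, doubleTwistCode, add_assoc]; exact Multiset.le_add_right _ _)
  have hB := twists_strand D (fun j => 4 * j + 2) (fun j => 4 * j + 3) q (by
    exact (Multiset.le_add_left _ _).trans (Multiset.le_add_right _ _))
  have s₁ : Relation.EqvGen D.Strand (4 * 0) (4 * 0 + 2) :=
    .rel _ _ (Or.inr (Or.inr (by simp [hD, doubleTwistCode])))
  have s₂ : Relation.EqvGen D.Strand (4 * p) (4 * 0 + 3) :=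
    .rel _ _ (Or.inr (Or.inr (by simp [hD, doubleTwistCode])))
  have s₃ : Relation.EqvGen D.Strand (4 * 0 + 1) (4 * q + 2) :=
    .rel _ _ (Or.inr (Or.inr (by simp [hD, doubleTwistCode])))
  have hAp := hA p le_rfl
  have hBq := hB q le_rfl
  rw [if_pos hp] at hAp
  rw [if_pos hq] at hBq
  have a₁ : Relation.EqvGen D.Strand (4 * 0) (4 * 0 + 1) :=
    (s₁.trans _ _ _ hBq.1).trans _ _ _ (s₃.symm _ _)
  have a₂ : Relation.EqvGen D.Strand (4 * 0) (4 * 0 + 3) := hAp.1.trans _ _ _ s₂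
  have all : ∀ x ∈ D.arcs, Relation.EqvGen D.Strand (4 * 0) x := by
    intro x hx
    rw [hD, doubleTwist_arcs, ← two_nsmul, Multiset.mem_nsmul] at hx
    have hx := hx.2
    simp only [doubleTwistT, twistsT, Multiset.map_add, Multiset.map_map, Function.comp_def,
      Multiset.mem_add, Multiset.mem_map, Multiset.mem_range] at hx
    rcases hx with (⟨i, hi, rfl⟩ | ⟨i, hi, rfl⟩) | (⟨i, hi, rfl⟩ | ⟨i, hi, rfl⟩)
    · have h := hA i (by omega)
      split_ifs at h
      · exact h.1
      · exact a₁.trans _ _ _ h.2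
    · have h := hA i (by omega)
      split_ifs at h
      · exact a₁.trans _ _ _ h.2
      · exact h.1
    · have h := hB i (by omega)
      split_ifs at h
      · exact s₁.trans _ _ _ h.1
      · exact a₂.trans _ _ _ h.2
    · have h := hB i (by omega)
      split_ifs at h
      · exact a₂.trans _ _ _ h.2
      · exact s₁.trans _ _ _ h.1
  intro x hx y hy
  exact ((all x hx).symm _ _).trans _ _ _ (all y hy)

/-- The double twist diagram with `p`, `q` even is a knot diagram. -/
def doubleTwistDiagram (p q : ℕ) (hp : Even p) (hq : Even q) : KnotDiagram where
  code := doubleTwistCode p q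
  arcsTwice := doubleTwist_arcsTwice p q
  oneComponent := doubleTwist_oneComponent p q hp hq
  planar := doubleTwist_planar p q

/-- The double twist knot `K(p, q)`, for `p`, `q` even. -/
def doubleTwistKnot (p q : ℕ) (hp : Even p) (hq : Even q) : Knot :=
  Quot.mk _ (doubleTwistDiagram p q hp hq)

end KnotDiag

/-!
Let `k + k⁻¹ + N = 0`. Colour the arcs of a diagram by `N` colours, give a crossing the weight
`k` times one smoothing plus the other one, and sum the products of the weights over all the
colourings: up to normalization this is the Kauffman bracket with loop value `N`, and the
Reidemeister moves change it by factors `±k ^ n` only. A row of `n` half twists acts like a single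
crossing with a coefficient `c n` such that `N * c n + 1 = (-k ^ 2) ^ n`, so that the bracket of
`D(p, q)`, for `p` and `q` even, is an affine function of
`(k ^ (2 * p) + N ^ 2 - 1) * (k ^ (2 * q) + N ^ 2 - 1)`.
For `N = 3` we can take `-2 / 5 < k < 0`. Then all these brackets lie between `-8 / 3` and
`-4 / 3`, which leaves no room for a factor `±k ^ n` other than `1`, and the terms `k ^ (2 * p)`
decay so fast that the product determines `p` and `q` up to order.
-/

namespace KnotDiag

section Resolution

variable {ι K : Type*} [DecidableEq ι] [CommRing K]

/-- The Kronecker delta: the weight of an arc whose ends carry the colours `i` and `j`. -/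
def delta (i j : ι) : K := if i = j then 1 else 0

theorem delta_comm (i j : ι) : (delta i j : K) = delta j i := by simp only [delta, eq_comm]

@[simp] theorem delta_self (i : ι) : (delta i i : K) = 1 := if_pos rfl

/-- The weight of a crossing that the colours `a`, `b`, `c`, `d` meet in counterclockwise order:
the combination of its two smoothings with coefficients `k` and `1`. For `k = A ^ 2` this is `A`
times the Kauffman bracket of the crossing. -/
def resolve (k : K) (a b c d : ι) : K := k * (delta a b * delta c d) + delta a d * delta b c

theorem resolve_rotate (k : K) (a b c d : ι) : resolve k c d a b = resolve k a b c d := by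
  simp only [resolve, delta_comm c b, delta_comm d a]
  ring

theorem resolve_quarter_rotate (k : Kˣ) (a b c d : ι) :
    resolve (k : K) b c d a = k * resolve (↑k⁻¹ : K) a b c d := by
  simp only [resolve, mul_add, Units.mul_inv_cancel_left, delta_comm b a, delta_comm d a]
  ring

variable [Fintype ι]

@[simp] theorem sum_delta_mul (i : ι) (g : ι → K) : ∑ c, delta i c * g c = g i := by
  simp [delta]

@[simp] theorem sum_delta_mul' (i : ι) (g : ι → K) : ∑ c, delta c i * g c = g i := by
  simp [delta]

theorem sum_resolve_mul (k : K) (a b : ι) (g : ι → ι → K) :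
    ∑ c, ∑ d, resolve k a b c d * g c d = k * delta a b * ∑ c, g c c + g b a := by
  simp [resolve, add_mul, Finset.sum_add_distrib, mul_assoc, ← Finset.mul_sum]

theorem sum_resolve_curl (k : K) (a c : ι) :
    ∑ b, resolve k a b b c = (k + Fintype.card ι) * delta a c := by
  simp [resolve, Finset.sum_add_distrib, ← Finset.mul_sum, add_mul]

theorem sum_resolve_curl' (k : K) (a c : ι) :
    ∑ b, resolve k b b a c = (k * Fintype.card ι + 1) * delta a c := by
  simp [resolve, Finset.sum_add_distrib, add_mul, mul_left_comm, mul_assoc, delta_comm c]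

theorem sum_resolve_mul_resolve (k k' : K) (a b c d : ι) :
    ∑ x, ∑ y, resolve k a b x y * resolve k' y x c d =
      resolve (k + k' + Fintype.card ι * k * k') a b c d := by
  rw [sum_resolve_mul k a b fun x y => resolve k' y x c d, sum_resolve_curl']
  simp only [resolve]
  ring

theorem sum_resolve_bigon {k : Kˣ} (hk : (k + ↑k⁻¹ + Fintype.card ι : K) = 0) (a b c d : ι) :
    ∑ x, ∑ y, resolve (k : K) a b x y * resolve (k : K) d y x c =
      k * (delta a d * delta b c) := by
  have hrot (x y : ι) : resolve (k : K) d y x c = k * resolve (↑k⁻¹ : K) y x c d := by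
    rw [resolve_quarter_rotate, resolve_rotate]
  have hzero : (k + ↑k⁻¹ + Fintype.card ι * k * ↑k⁻¹ : K) = 0 := by
    rw [mul_assoc, Units.mul_inv, mul_one, hk]
  simp only [hrot, mul_left_comm _ (k : K), ← Finset.mul_sum, sum_resolve_mul_resolve, hzero]
  simp only [resolve, zero_mul, zero_add]

theorem sum_resolve_triangle {k : Kˣ} (hk : (k + ↑k⁻¹ + Fintype.card ι : K) = 0) (k' : K)
    (e₁ e₂ e₃ e₄ e₅ e₆ : ι) :
    ∑ y, ∑ z, ∑ x,
        resolve (k : K) e₁ e₂ x y * (resolve (k : K) e₄ z x e₃ * resolve k' e₅ e₆ y z) =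
      ∑ y, ∑ z, ∑ x,
        resolve (k : K) e₄ e₅ x y * (resolve (k : K) e₁ z x e₆ * resolve k' e₂ e₃ y z) := by
  -- Smooth only the third crossing: one smoothing leaves a bigon, and the other one leaves two
  -- crossings in a row that are the same on both sides.
  have smooth (a b c d e f : ι) :
      ∑ y, ∑ z, ∑ x, resolve (k : K) a b x y * (resolve (k : K) d z x c * resolve k' e f y z) =
        k' * delta e f * (k * (delta a d * delta b c)) +
          ∑ x, resolve (k : K) a b x f * resolve (k : K) d e x c := by
    simp only [← mul_assoc, mul_comm _ (resolve k' _ _ _ _)]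
    simp only [mul_assoc, ← Finset.mul_sum]
    rw [sum_resolve_mul k' e f fun y z => ∑ x, resolve (k : K) a b x y * resolve (k : K) d z x c,
      Finset.sum_comm, sum_resolve_bigon hk, mul_assoc]
  rw [smooth, smooth, delta_comm e₄ e₁]
  simp only [mul_comm (resolve (k : K) e₄ _ _ _)]
  ring

end Resolution

section StateSum

variable {ι K : Type*} [Fintype ι] [CommRing K]

/-- Summation of a function of colourings over the colour of the arc `a`. -/
def sumOut (a : ℕ) (Φ : (ℕ → ι) → K) (f : ℕ → ι) : K := ∑ c, Φ (Function.update f a c)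

instance : LeftCommutative (sumOut (ι := ι) (K := K)) where
  left_comm a b Φ := by
    rcases eq_or_ne a b with rfl | h
    · rfl
    · funext f
      simp only [sumOut, Function.update_comm h]
      exact Finset.sum_comm

/-- Summation of a function of colourings over the colours of all the arcs in `s`. -/
def sumOver (s : Multiset ℕ) (Φ : (ℕ → ι) → K) : (ℕ → ι) → K := s.foldr sumOut Φ

@[simp] theorem sumOver_zero (Φ : (ℕ → ι) → K) : sumOver 0 Φ = Φ := rfl

@[simp] theorem sumOver_cons (a : ℕ) (s : Multiset ℕ) (Φ : (ℕ → ι) → K) (f : ℕ → ι) :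
    sumOver (a ::ₘ s) Φ f = ∑ c, sumOver s Φ (Function.update f a c) := by
  rw [sumOver, Multiset.foldr_cons, sumOut]
  rfl

@[simp] theorem sumOver_singleton (a : ℕ) (Φ : (ℕ → ι) → K) (f : ℕ → ι) :
    sumOver {a} Φ f = ∑ c, Φ (Function.update f a c) := sumOver_cons a 0 Φ f

theorem sumOver_add (s t : Multiset ℕ) (Φ : (ℕ → ι) → K) :
    sumOver (s + t) Φ = sumOver t (sumOver s Φ) := by
  rw [sumOver, add_comm, Multiset.foldr_add]
  rfl

theorem sumOver_congr {s : Multiset ℕ} {Φ Ψ : (ℕ → ι) → K} {f : ℕ → ι}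
    (h : ∀ g, (∀ x ∉ s, g x = f x) → Φ g = Ψ g) : sumOver s Φ f = sumOver s Ψ f := by
  induction s using Multiset.induction_on generalizing f with
  | empty => exact h f fun _ _ => rfl
  | cons a s ih =>
    simp only [sumOver_cons]
    refine Finset.sum_congr rfl fun c _ => ih fun g hg => h g fun x hx => ?_
    rw [Multiset.mem_cons, not_or] at hx
    rw [hg x hx.2, Function.update_of_ne hx.1]

theorem sumOver_const_mul (s : Multiset ℕ) (m : K) (Φ : (ℕ → ι) → K) (f : ℕ → ι) :
    sumOver s (fun g => m * Φ g) f = m * sumOver s Φ f := by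
  induction s using Multiset.induction_on generalizing f with
  | empty => rfl
  | cons a s ih => simp only [sumOver_cons, ih, Finset.mul_sum]

theorem sumOver_mul_of_forall {s : Multiset ℕ} {Φ Ψ : (ℕ → ι) → K} {f : ℕ → ι}
    (h : ∀ g, (∀ x ∉ s, g x = f x) → Ψ g = Ψ f) :
    sumOver s (fun g => Φ g * Ψ g) f = sumOver s Φ f * Ψ f := by
  rw [mul_comm, ← sumOver_const_mul]
  exact sumOver_congr fun g hg => by rw [h g hg, mul_comm]

theorem sumOver_map (σ : Equiv.Perm ℕ) (s : Multiset ℕ) (Φ : (ℕ → ι) → K) (f : ℕ → ι) :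
    sumOver (s.map σ) (fun g => Φ (g ∘ σ)) f = sumOver s Φ (f ∘ σ) := by
  induction s using Multiset.induction_on generalizing f with
  | empty => rfl
  | cons a s ih =>
    simp only [Multiset.map_cons, sumOver_cons, ih, Function.update_comp_equiv,
      Equiv.symm_apply_apply]

end StateSum

section Bracket

variable {ι K : Type*} [DecidableEq ι] [CommRing K]

/-- The weight of a vertex in the state that colours the arcs by `f`. -/
def Node.weight (k : K) (f : ℕ → ι) : Node → K
  | .cross a b c d => resolve k (f a) (f b) (f c) (f d)
  | .pt a b => delta (f a) (f b)

/-- The weight of a state: the product of the weights of the vertices. -/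
def Code.weight (k : K) (D : Code) (f : ℕ → ι) : K := (D.map (Node.weight k f)).prod

theorem Node.arcs_cross (a b c d : ℕ) : (Node.cross a b c d).arcs = {a, b, c, d} := rfl

theorem Node.weight_cross (k : K) (f : ℕ → ι) (a b c d : ℕ) :
    (Node.cross a b c d).weight k f = resolve k (f a) (f b) (f c) (f d) := rfl

theorem Code.arcs_add (D D' : Code) : Code.arcs (D + D') = D.arcs + D'.arcs :=
  Multiset.add_bind D D' _

theorem Code.arcs_cons (v : Node) (D : Code) : Code.arcs (v ::ₘ D) = v.arcs + D.arcs :=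
  Multiset.cons_bind v D _

@[simp] theorem Code.arcs_singleton (v : Node) : Code.arcs {v} = v.arcs :=
  Multiset.singleton_bind v _

theorem Code.arcs_relabel (D : Code) (σ : ℕ → ℕ) :
    Code.arcs (D.map (Node.relabel σ)) = D.arcs.map σ := by
  rw [Code.arcs, Multiset.bind_map, Code.arcs, Multiset.map_bind]
  refine Multiset.bind_congr fun v _ => ?_
  cases v <;> simp [Node.relabel, Node.arcs]

theorem Code.weight_add (k : K) (D D' : Code) (f : ℕ → ι) :
    Code.weight k (D + D') f = D.weight k f * D'.weight k f := by
  rw [Code.weight, Multiset.map_add, Multiset.prod_add]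
  rfl

theorem Code.weight_cons (k : K) (v : Node) (D : Code) (f : ℕ → ι) :
    Code.weight k (v ::ₘ D) f = v.weight k f * D.weight k f := by
  rw [Code.weight, Multiset.map_cons, Multiset.prod_cons]
  rfl

@[simp] theorem Code.weight_singleton (k : K) (v : Node) (f : ℕ → ι) :
    Code.weight k {v} f = v.weight k f := by
  rw [Code.weight, Multiset.map_singleton, Multiset.prod_singleton]

theorem Code.weight_relabel (k : K) (D : Code) (σ : ℕ → ℕ) (f : ℕ → ι) :
    Code.weight k (D.map (Node.relabel σ)) f = D.weight k (f ∘ σ) := by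
  rw [Code.weight, Multiset.map_map, Code.weight]
  refine congrArg Multiset.prod (Multiset.map_congr rfl fun v _ => ?_)
  cases v <;> rfl

theorem Node.weight_congr (k : K) {v : Node} {f g : ℕ → ι} (h : ∀ x ∈ v.arcs, f x = g x) :
    v.weight k f = v.weight k g := by
  cases v <;> simp_all [Node.arcs, Node.weight]

theorem Code.weight_congr (k : K) {D : Code} {f g : ℕ → ι} (h : ∀ x ∈ D.arcs, f x = g x) :
    D.weight k f = D.weight k g :=
  congrArg Multiset.prod <| Multiset.map_congr rfl fun v hv =>
    v.weight_congr k fun x hx => h x (Multiset.mem_bind.2 ⟨v, hv, hx⟩)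

theorem Node.Same.arcs_eq {v w : Node} (h : Node.Same v w) : v.arcs = w.arcs := by
  cases h with
  | refl => rfl
  | rotate a b c d =>
    simp only [Node.arcs, Multiset.insert_eq_cons, ← Multiset.singleton_add]
    abel
  | swap a b => exact Multiset.pair_comm a b

theorem Node.Same.weight_eq {v w : Node} (h : Node.Same v w) (k : K) (f : ℕ → ι) :
    v.weight k f = w.weight k f := by
  cases h with
  | refl => rfl
  | rotate a b c d => exact (resolve_rotate k _ _ _ _).symm
  | swap a b => exact delta_comm _ _

theorem Code.ArcsTwice.nodup_disjoint {D : Code} (h : D.ArcsTwice) {s o : Multiset ℕ}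
    (hD : D.arcs = s + s + o) : s.Nodup ∧ Disjoint s o := by
  have count_eq (x : ℕ) (hx : x ∈ s) : s.count x + s.count x + o.count x = 2 := by
    rw [← Multiset.count_add, ← Multiset.count_add, ← hD]
    exact h x (by simp [hD, hx])
  rw [Multiset.nodup_iff_count_le_one, Multiset.disjoint_left]
  refine ⟨fun x => ?_, fun {x} hx hxo => ?_⟩
  · by_cases hx : x ∈ s
    · linarith [count_eq x hx]
    · simp [Multiset.count_eq_zero_of_notMem hx]
  · linarith [count_eq x hx, Multiset.one_le_count_iff_mem.2 hx,
      Multiset.one_le_count_iff_mem.2 hxo]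

theorem dedup_add_self_add {s o : Multiset ℕ} (hs : s.Nodup) (hso : Disjoint s o) :
    (s + s + o).dedup = s + o.dedup := by
  refine (Multiset.Nodup.ext (Multiset.nodup_dedup _) ?_).2 fun x => by simp
  rw [Multiset.nodup_add]
  refine ⟨hs, Multiset.nodup_dedup o, Multiset.disjoint_left.2 fun hx hxo => ?_⟩
  exact Multiset.disjoint_left.1 hso hx (Multiset.mem_dedup.1 hxo)

variable [Fintype ι] [Inhabited ι]

variable (ι) in
/-- The Kauffman bracket with loop value the number of colours, as a state sum over the colourings
of the arcs by `ι`. It is normalized to be `1` for the empty diagram, and its skein relation is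
rescaled as in `resolve`. All arcs being summed over, the colouring `default` is irrelevant. -/
def Code.bracket (k : K) (D : Code) : K := sumOver D.arcs.dedup (D.weight k) fun _ => (default : ι)

theorem Code.ArcsTwice.bracket_add {T R : Code} (h : Code.ArcsTwice (T + R)) {s o : Multiset ℕ}
    (hT : T.arcs = s + s + o) (k : K) :
    Code.bracket ι k (T + R) = sumOver (o + R.arcs).dedup
      (fun f => sumOver s (T.weight k) f * R.weight k f) fun _ => (default : ι) := by
  have harcs : Code.arcs (T + R) = s + s + (o + R.arcs) := by rw [Code.arcs_add, hT, add_assoc]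
  obtain ⟨hs, hdisj⟩ := h.nodup_disjoint harcs
  have hR (x : ℕ) (hx : x ∈ R.arcs) : x ∉ s := fun hxs =>
    Multiset.disjoint_left.1 hdisj hxs (Multiset.mem_add.2 (.inr hx))
  rw [Code.bracket, harcs, dedup_add_self_add hs hdisj, sumOver_add]
  congr 1
  funext f
  rw [← sumOver_mul_of_forall fun g hg => Code.weight_congr k fun x hx => hg x (hR x hx)]
  rw [funext (Code.weight_add k T R)]

/-- Here `s` and `s'` are the inner arcs of the tangles `T` and `T'`, and `o` their common ends. -/
theorem Code.bracket_replace {T T' R : Code} (h : Code.ArcsTwice (T + R))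
    (h' : Code.ArcsTwice (T' + R)) {s s' o : Multiset ℕ} (hT : T.arcs = s + s + o)
    (hT' : T'.arcs = s' + s' + o) {k m : K}
    (hm : s.Nodup → Disjoint s o → ∀ f : ℕ → ι,
      sumOver s (T.weight k) f = m * sumOver s' (T'.weight k) f) :
    Code.bracket ι k (T + R) = m * Code.bracket ι k (T' + R) := by
  obtain ⟨hs, hdisj⟩ := h.nodup_disjoint (s := s) (o := o + R.arcs)
    (by rw [Code.arcs_add, hT, add_assoc])
  rw [h.bracket_add hT, h'.bracket_add hT', ← sumOver_const_mul]
  simp only [hm hs (Multiset.disjoint_add_right.1 hdisj).1, mul_assoc]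

theorem bracket_relabel (k : K) (σ : Equiv.Perm ℕ) (D : Code) :
    Code.bracket ι k (D.map (Node.relabel σ)) = D.bracket ι k := by
  have hweight : Code.weight k (D.map (Node.relabel σ)) =
      fun g : ℕ → ι => D.weight k (g ∘ σ) := funext fun g => D.weight_relabel k σ g
  rw [Code.bracket, Code.arcs_relabel, Multiset.dedup_map_of_injective σ.injective, hweight,
    sumOver_map]
  rfl

theorem bracket_same (k : K) {D D' : Code} (h : Multiset.Rel Node.Same D D') :
    D.bracket ι k = D'.bracket ι k := by
  have key : D.arcs = D'.arcs ∧ ∀ f : ℕ → ι, D.weight k f = D'.weight k f := by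
    induction h with
    | zero => exact ⟨rfl, fun _ => rfl⟩
    | cons hv _ ih =>
      refine ⟨by rw [Code.arcs_cons, Code.arcs_cons, hv.arcs_eq, ih.1], fun f => ?_⟩
      rw [Code.weight_cons, Code.weight_cons, hv.weight_eq, ih.2]
  rw [Code.bracket, Code.bracket, key.1, funext key.2]

theorem bracket_unmark (k : K) {a b : ℕ} (hab : a ≠ b) (R : Code)
    (h : Code.ArcsTwice (Node.pt a b ::ₘ R)) :
    Code.bracket ι k (Node.pt a b ::ₘ R) =
      Code.bracket ι k (R.map (Node.relabel fun x => if x = b then a else x)) := by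
  have hbR : b ∈ Code.arcs R := by
    have hb := h b (by simp [Code.arcs_cons, Node.arcs])
    rw [← Multiset.count_pos]
    simp only [Code.arcs_cons, Node.arcs, Multiset.insert_eq_cons, Multiset.count_add,
      Multiset.count_cons, Multiset.count_singleton, hab.symm, if_true, if_false] at hb
    lia
  have hdedup : (Code.arcs (Node.pt a b ::ₘ R)).dedup =
      {b} + (Code.arcs (R.map (Node.relabel fun x => if x = b then a else x))).dedup := by
    refine (Multiset.Nodup.ext (Multiset.nodup_dedup _) ?_).2 ?_
    · simp only [Multiset.nodup_add, Multiset.nodup_singleton, Multiset.nodup_dedup, true_and,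
        Multiset.singleton_disjoint, Multiset.mem_dedup, Code.arcs_relabel, Multiset.mem_map]
      grind
    · simp only [Code.arcs_cons, Code.arcs_relabel, Node.arcs, Multiset.insert_eq_cons,
        Multiset.cons_add, Multiset.singleton_add, Multiset.mem_dedup, Multiset.mem_cons,
        Multiset.mem_map]
      grind
  have hcomp (f : ℕ → ι) :
      f ∘ (fun x => if x = b then a else x) = Function.update f b (f a) := by
    funext x
    by_cases hx : x = b <;> simp [hx]
  rw [Code.bracket, hdedup, sumOver_add, Code.bracket]
  congr 1
  funext f
  simp [Code.weight_cons, Node.weight, hab, Code.weight_relabel, hcomp]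

end Bracket

section Invariance

variable {ι K : Type*} [DecidableEq ι] [Fintype ι] [Inhabited ι] [CommRing K] {k : Kˣ}

theorem bracket_reidemeister1 (hk : (k + ↑k⁻¹ + Fintype.card ι : K) = 0) {a b c : ℕ} {R : Code}
    (h : Code.ArcsTwice (Node.cross a b b c ::ₘ R)) (h' : Code.ArcsTwice (Node.pt a c ::ₘ R)) :
    Code.bracket ι (k : K) (Node.cross a b b c ::ₘ R) =
      -↑k⁻¹ * Code.bracket ι (k : K) (Node.pt a c ::ₘ R) := by
  have hcurl : (k + Fintype.card ι : K) = -↑k⁻¹ := by linear_combination hk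
  refine Code.bracket_replace (T := {Node.cross a b b c}) (T' := {Node.pt a c}) (s := {b})
    (s' := 0) (o := {a, c}) h h' ?_ ?_ fun _ hdisj f => ?_
  · simp only [Code.arcs_singleton, Node.arcs, Multiset.insert_eq_cons, ← Multiset.singleton_add]
    abel
  · simp [Node.arcs]
  · have hba : a ≠ b ∧ c ≠ b := by simpa [eq_comm] using hdisj
    simp [Node.weight, hba, sum_resolve_curl, hcurl]

theorem bracket_reidemeister1' (hk : (k + ↑k⁻¹ + Fintype.card ι : K) = 0) {a b c : ℕ} {R : Code}
    (h : Code.ArcsTwice (Node.cross b b a c ::ₘ R)) (h' : Code.ArcsTwice (Node.pt a c ::ₘ R)) :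
    Code.bracket ι (k : K) (Node.cross b b a c ::ₘ R) =
      -(k : K) ^ 2 * Code.bracket ι (k : K) (Node.pt a c ::ₘ R) := by
  have hcurl : (k * Fintype.card ι + 1 : K) = -(k : K) ^ 2 := by
    linear_combination (k : K) * hk - k.mul_inv
  refine Code.bracket_replace (T := {Node.cross b b a c}) (T' := {Node.pt a c}) (s := {b})
    (s' := 0) (o := {a, c}) h h' ?_ ?_ fun _ hdisj f => ?_
  · simp only [Code.arcs_singleton, Node.arcs, Multiset.insert_eq_cons, ← Multiset.singleton_add]
    abel
  · simp [Node.arcs]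
  · have hba : a ≠ b ∧ c ≠ b := by simpa [eq_comm] using hdisj
    simp [Node.weight, hba, sum_resolve_curl', hcurl]

theorem bracket_reidemeister2 (hk : (k + ↑k⁻¹ + Fintype.card ι : K) = 0) {a b c d e f : ℕ}
    {R : Code} (h : Code.ArcsTwice ({Node.cross a f e b, Node.cross e f c d} + R))
    (h' : Code.ArcsTwice ({Node.pt a c, Node.pt b d} + R)) :
    Code.bracket ι (k : K) ({Node.cross a f e b, Node.cross e f c d} + R) =
      k * Code.bracket ι (k : K) ({Node.pt a c, Node.pt b d} + R) := by
  refine Code.bracket_replace (s := {e, f}) (s' := 0) (o := {a, b, c, d}) h h' ?_ ?_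
    fun hnodup hdisj g => ?_
  · simp only [Code.arcs_add, Code.arcs_singleton, Node.arcs, Multiset.insert_eq_cons,
      ← Multiset.singleton_add]
    abel
  · simp only [Code.arcs_add, Code.arcs_singleton, Node.arcs, Multiset.insert_eq_cons,
      ← Multiset.singleton_add]
    abel
  · have hne : e ≠ f := by simpa using hnodup
    simp only [Multiset.insert_eq_cons, Multiset.disjoint_cons_left, Multiset.mem_cons,
      Multiset.mem_singleton, Multiset.singleton_disjoint, not_or] at hdisj
    obtain ⟨⟨hea, heb, hec, hed⟩, hfa, hfb, hfc, hfd⟩ := hdisj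
    simp only [Multiset.insert_eq_cons, sumOver_cons, sumOver_singleton, sumOver_zero,
      Code.weight_cons, Code.weight_singleton, Node.weight, Function.update_self,
      Function.update_of_ne, ne_eq, not_false_eq_true, hne, Ne.symm, hea, heb, hec, hed, hfa, hfb,
      hfc, hfd]
    rw [Finset.sum_congr rfl fun x _ => Finset.sum_congr rfl fun y _ => by
      rw [mul_comm, resolve_rotate (k : K) (g c) (g d)]]
    rw [sum_resolve_bigon hk, delta_comm (g c), delta_comm (g d)]

/-- The two kinds of third Reidemeister move are the cases `k' = k` and `k' = k⁻¹`. -/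
theorem bracket_triangle (hk : (k + ↑k⁻¹ + Fintype.card ι : K) = 0)
    {e₁ e₂ e₃ e₄ e₅ e₆ x y z : ℕ} {v v' : Node} {R : Code}
    (h : Code.ArcsTwice ({Node.cross e₁ e₂ x y, Node.cross e₄ z x e₃, v} + R))
    (h' : Code.ArcsTwice ({Node.cross e₄ e₅ x y, Node.cross e₁ z x e₆, v'} + R))
    (hv : v.arcs = {e₅, e₆, y, z}) (hv' : v'.arcs = {e₂, e₃, y, z}) {k' m : K}
    (hw : ∀ g : ℕ → ι, v.weight (k : K) g = m * resolve k' (g e₅) (g e₆) (g y) (g z))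
    (hw' : ∀ g : ℕ → ι, v'.weight (k : K) g = m * resolve k' (g e₂) (g e₃) (g y) (g z)) :
    Code.bracket ι (k : K) ({Node.cross e₁ e₂ x y, Node.cross e₄ z x e₃, v} + R) =
      Code.bracket ι (k : K) ({Node.cross e₄ e₅ x y, Node.cross e₁ z x e₆, v'} + R) := by
  rw [← one_mul (Code.bracket ι (k : K) ({Node.cross e₄ e₅ x y, _, _} + R))]
  refine Code.bracket_replace (s := {y, z, x}) (s' := {y, z, x}) (o := {e₁, e₂, e₃, e₄, e₅, e₆})
    h h' ?_ ?_ fun hnodup hdisj g => ?_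
  · simp only [Code.arcs_add, Code.arcs_singleton, hv, Node.arcs_cross, Multiset.insert_eq_cons,
      ← Multiset.singleton_add]
    abel
  · simp only [Code.arcs_add, Code.arcs_singleton, hv', Node.arcs_cross, Multiset.insert_eq_cons,
      ← Multiset.singleton_add]
    abel
  · simp only [Multiset.insert_eq_cons, Multiset.nodup_cons, Multiset.disjoint_cons_left,
      Multiset.mem_cons, Multiset.mem_singleton, Multiset.singleton_disjoint, not_or]
      at hnodup hdisj
    simpa [Code.weight_cons, Node.weight_cross, hw, hw', hnodup, hdisj, Ne.symm, mul_left_comm _ m,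
      ← Finset.mul_sum] using congrArg (m * ·) (sum_resolve_triangle hk k' (g e₁) (g e₂) (g e₃)
        (g e₄) (g e₅) (g e₆))

theorem bracket_reidemeister3 (hk : (k + ↑k⁻¹ + Fintype.card ι : K) = 0)
    {e₁ e₂ e₃ e₄ e₅ e₆ x y z : ℕ} {R : Code}
    (h : Code.ArcsTwice ({Node.cross e₁ e₂ x y, Node.cross e₄ z x e₃, Node.cross e₅ e₆ y z} + R))
    (h' : Code.ArcsTwice
      ({Node.cross e₄ e₅ x y, Node.cross e₁ z x e₆, Node.cross e₂ e₃ y z} + R)) :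
    Code.bracket ι (k : K)
        ({Node.cross e₁ e₂ x y, Node.cross e₄ z x e₃, Node.cross e₅ e₆ y z} + R) =
      Code.bracket ι (k : K)
        ({Node.cross e₄ e₅ x y, Node.cross e₁ z x e₆, Node.cross e₂ e₃ y z} + R) :=
  bracket_triangle hk h h' rfl rfl (fun _ => (one_mul _).symm) fun _ => (one_mul _).symm

theorem bracket_reidemeister3' (hk : (k + ↑k⁻¹ + Fintype.card ι : K) = 0)
    {e₁ e₂ e₃ e₄ e₅ e₆ x y z : ℕ} {R : Code}
    (h : Code.ArcsTwice ({Node.cross e₁ e₂ x y, Node.cross e₄ z x e₃, Node.cross e₆ y z e₅} + R))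
    (h' : Code.ArcsTwice
      ({Node.cross e₄ e₅ x y, Node.cross e₁ z x e₆, Node.cross e₃ y z e₂} + R)) :
    Code.bracket ι (k : K)
        ({Node.cross e₁ e₂ x y, Node.cross e₄ z x e₃, Node.cross e₆ y z e₅} + R) =
      Code.bracket ι (k : K)
        ({Node.cross e₄ e₅ x y, Node.cross e₁ z x e₆, Node.cross e₃ y z e₂} + R) := by
  have harcs (a b c d : ℕ) : ({b, c, d, a} : Multiset ℕ) = {a, b, c, d} := by
    simp only [Multiset.insert_eq_cons, ← Multiset.singleton_add]
    abel
  exact bracket_triangle hk h h' (harcs ..) (harcs ..)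
    (fun _ => resolve_quarter_rotate k _ _ _ _) fun _ => resolve_quarter_rotate k _ _ _ _

/-- The units up to which the bracket is invariant under all the moves. -/
def signedPowers (k : Kˣ) : Subgroup Kˣ := Subgroup.closure {-1, k}

theorem Move.bracket_eq (hk : (k + ↑k⁻¹ + Fintype.card ι : K) = 0) {D D' : Code} (h : Move D D')
    (hD : D.ArcsTwice) (hD' : D'.ArcsTwice) :
    ∃ w ∈ signedPowers k, D.bracket ι (k : K) = (w : K) * D'.bracket ι (k : K) := by
  have hneg : -1 ∈ signedPowers k := Subgroup.subset_closure (by simp)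
  have hself : k ∈ signedPowers k := Subgroup.subset_closure (by simp)
  cases h with
  | rename σ h => exact ⟨1, one_mem _, by rw [← bracket_same _ h, bracket_relabel]; simp⟩
  | unmark h R => exact ⟨1, one_mem _, by rw [bracket_unmark _ h R hD]; simp⟩
  | reidemeister1 =>
    refine ⟨-1 * k⁻¹, mul_mem hneg (inv_mem hself), ?_⟩
    rw [bracket_reidemeister1 hk hD hD']
    simp
  | reidemeister1' =>
    refine ⟨-1 * k ^ 2, mul_mem hneg (pow_mem hself 2), ?_⟩
    rw [bracket_reidemeister1' hk hD hD']
    simp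
  | reidemeister2 => exact ⟨k, hself, bracket_reidemeister2 hk hD hD'⟩
  | reidemeister3 => exact ⟨1, one_mem _, by rw [bracket_reidemeister3 hk hD hD']; simp⟩
  | reidemeister3' => exact ⟨1, one_mem _, by rw [bracket_reidemeister3' hk hD hD']; simp⟩

/-- The bracket of a knot, an element of `K` up to multiplication by `-1` and `k`. -/
def Knot.bracket (hk : (k + ↑k⁻¹ + Fintype.card ι : K) = 0) (x : Knot) :
    MulAction.orbitRel.Quotient (signedPowers k) K :=
  Quot.lift (fun D : KnotDiagram => Quotient.mk _ (D.code.bracket ι (k : K)))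
    (fun D D' h => by
      obtain ⟨w, hw, h⟩ := h.bracket_eq hk D.arcsTwice D'.arcsTwice
      exact Quotient.sound ⟨⟨w, hw⟩, h.symm⟩) x

theorem exists_bracket_eq_of_mk_eq (hk : (k + ↑k⁻¹ + Fintype.card ι : K) = 0)
    {D D' : KnotDiagram} (h : (Quot.mk _ D : Knot) = Quot.mk _ D') :
    ∃ w ∈ signedPowers k, D.code.bracket ι (k : K) = (w : K) * D'.code.bracket ι (k : K) := by
  obtain ⟨w, hw⟩ := Quotient.exact (congrArg (Knot.bracket hk) h)
  exact ⟨w, w.2, hw.symm⟩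

end Invariance

section DoubleTwist

variable {ι K : Type*} [CommRing K]

/-- The arcs of a row of `n` half twists, each listed once. -/
def rowArcs (l r : ℕ → ℕ) (n : ℕ) : Multiset ℕ :=
  (Multiset.range (n + 1)).map l + (Multiset.range (n + 1)).map r

theorem rowArcs_succ (l r : ℕ → ℕ) (n : ℕ) :
    rowArcs l r (n + 1) = {r (n + 1), l (n + 1)} + rowArcs l r n := by
  simp only [rowArcs, Multiset.range_succ (n := n + 1), Multiset.map_cons]
  simp only [Multiset.insert_eq_cons, ← Multiset.singleton_add]
  abel

theorem mem_rowArcs {l r : ℕ → ℕ} {n x : ℕ} :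
    x ∈ rowArcs l r n ↔ ∃ i ≤ n, l i = x ∨ r i = x := by
  simp only [rowArcs, Multiset.mem_add, Multiset.mem_map, Multiset.mem_range, Nat.lt_succ_iff,
    ← exists_or, ← and_or_left]

section

variable [DecidableEq ι]

theorem weight_twists (k : K) (l r : ℕ → ℕ) (n : ℕ) (f : ℕ → ι) :
    (twists l r n).weight k f =
      ∏ i ∈ Finset.range n, resolve k (f (l i)) (f (r i)) (f (r (i + 1))) (f (l (i + 1))) := by
  rw [Code.weight, twists, Multiset.map_map]
  rfl

theorem weight_twists_succ (k : K) (l r : ℕ → ℕ) (n : ℕ) (f : ℕ → ι) :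
    (twists l r (n + 1)).weight k f = (twists l r n).weight k f *
      resolve k (f (l n)) (f (r n)) (f (r (n + 1))) (f (l (n + 1))) := by
  simp only [weight_twists, Finset.prod_range_succ]

theorem weight_twists_congr (k : K) {l r : ℕ → ℕ} {n : ℕ} {f g : ℕ → ι}
    (h : ∀ x ∈ rowArcs l r n, f x = g x) :
    (twists l r n).weight k f = (twists l r n).weight k g := by
  have hl (i : ℕ) (hi : i ≤ n) : f (l i) = g (l i) := h _ (mem_rowArcs.2 ⟨i, hi, .inl rfl⟩)
  have hr (i : ℕ) (hi : i ≤ n) : f (r i) = g (r i) := h _ (mem_rowArcs.2 ⟨i, hi, .inr rfl⟩)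
  simp only [weight_twists]
  refine Finset.prod_congr rfl fun i hi => ?_
  have hi := Finset.mem_range.1 hi
  rw [hl i hi.le, hr i hi.le, hl (i + 1) hi, hr (i + 1) hi]

end

variable [Fintype ι]

variable (ι) in
/-- A row of `n` half twists contributes to the state sum like a single crossing with
`twistCoeff ι k n` in place of the coefficient `k` of `resolve`. -/
def twistCoeff (k : K) : ℕ → K
  | 0 => 0
  | n + 1 => twistCoeff k n + k + Fintype.card ι * twistCoeff k n * k

theorem card_mul_twistCoeff_add_one (k : K) (n : ℕ) :
    Fintype.card ι * twistCoeff ι k n + 1 = (k * Fintype.card ι + 1) ^ n := by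
  induction n with
  | zero => simp [twistCoeff]
  | succ n ih =>
    rw [twistCoeff, pow_succ]
    linear_combination (k * Fintype.card ι + 1) * ih

variable [DecidableEq ι]

theorem sumOver_rowArcs (k : K) {l r : ℕ → ℕ} (hl : l.Injective) (hr : r.Injective)
    (hlr : ∀ i j, l i ≠ r j) (n : ℕ) (G : ι → ι → ι → ι → K) (f : ℕ → ι) :
    sumOver (rowArcs l r n)
        (fun g => (twists l r n).weight k g * G (g (l 0)) (g (r 0)) (g (r n)) (g (l n))) f =
      ∑ a, ∑ b, ∑ c, ∑ d, resolve (twistCoeff ι k n) a b c d * G a b c d := by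
  induction n generalizing G f with
  | zero =>
    simp [rowArcs, weight_twists, twistCoeff, sum_resolve_mul, hlr]
  | succ n ih =>
    have hout (x : ℕ) (hx : x ∈ rowArcs l r n) : x ≠ l (n + 1) ∧ x ≠ r (n + 1) := by
      obtain ⟨i, hi, rfl | rfl⟩ := mem_rowArcs.1 hx
      · exact ⟨hl.ne (by lia), hlr _ _⟩
      · exact ⟨(hlr _ _).symm, hr.ne (by lia)⟩
    have hinner (g : ℕ → ι) : sumOver {r (n + 1), l (n + 1)}
          (fun g => (twists l r (n + 1)).weight k g *
            G (g (l 0)) (g (r 0)) (g (r (n + 1))) (g (l (n + 1)))) g =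
        (twists l r n).weight k g *
          ∑ c, ∑ d, resolve k (g (l n)) (g (r n)) c d * G (g (l 0)) (g (r 0)) c d := by
      have hconst (c d : ι) : (twists l r n).weight k
          (Function.update (Function.update g (r (n + 1)) c) (l (n + 1)) d) =
            (twists l r n).weight k g :=
        weight_twists_congr k fun x hx => by simp [hout x hx]
      simp only [Multiset.insert_eq_cons, sumOver_cons, sumOver_singleton, weight_twists_succ,
        hconst]
      simp [mul_assoc, ← Finset.mul_sum, hl.eq_iff, hr.eq_iff, hlr, (hlr _ _).symm]
    rw [rowArcs_succ, sumOver_add, funext hinner, ih fun a b x y =>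
      ∑ c, ∑ d, resolve k y x c d * G a b c d]
    simp only [twistCoeff, sum_resolve_mul]
    refine Finset.sum_congr rfl fun a _ => Finset.sum_congr rfl fun b _ => ?_
    simp only [delta_self, mul_one, Finset.sum_add_distrib, Finset.sum_const, Finset.card_univ,
      nsmul_eq_mul]
    ring

theorem doubleTwist_arcs_dedup (p q : ℕ) : (doubleTwistCode p q).arcs.dedup =
    rowArcs (fun i => 4 * i) (fun i => 4 * i + 1) p +
      rowArcs (fun j => 4 * j + 2) (fun j => 4 * j + 3) q := by
  have hmap : (doubleTwistT p q).map Prod.fst =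
      rowArcs (fun i => 4 * i) (fun i => 4 * i + 1) p +
        rowArcs (fun j => 4 * j + 2) (fun j => 4 * j + 3) q := by
    simp [doubleTwistT, twistsT, rowArcs]
  rw [doubleTwist_arcs, ← hmap]
  simpa using dedup_add_self_add (o := 0) (doubleTwistT_nodup p q) disjoint_bot_right

theorem sumOver_doubleTwist_fst (k : K) (p q : ℕ) (f : ℕ → ι) :
    sumOver (rowArcs (fun i => 4 * i) (fun i => 4 * i + 1) p)
        ((doubleTwistCode p q).weight k) f =
      (twists (fun j => 4 * j + 2) (fun j => 4 * j + 3) q).weight k f *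
        resolve (twistCoeff ι k p) (f (4 * 0 + 2)) (f (4 * q + 2)) (f (4 * q + 3))
          (f (4 * 0 + 3)) := by
  let G (a b c d : ι) : K := (twists (fun j => 4 * j + 2) (fun j => 4 * j + 3) q).weight k f *
    (delta d (f (4 * 0 + 3)) * (delta c (f (4 * q + 3)) *
      (delta b (f (4 * q + 2)) * delta a (f (4 * 0 + 2)))))
  have hsplit (g : ℕ → ι)
      (hg : ∀ x ∉ rowArcs (fun i => 4 * i) (fun i => 4 * i + 1) p, g x = f x) :
      (doubleTwistCode p q).weight k g =
        (twists (fun i => 4 * i) (fun i => 4 * i + 1) p).weight k g *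
          G (g (4 * 0)) (g (4 * 0 + 1)) (g (4 * p + 1)) (g (4 * p)) := by
    have hsnd (x : ℕ) (hx : x ∈ rowArcs (fun j => 4 * j + 2) (fun j => 4 * j + 3) q) :
        g x = f x := by
      refine hg x ?_
      simp only [mem_rowArcs] at hx ⊢
      lia
    have hl (j : ℕ) (hj : j ≤ q) : g (4 * j + 2) = f (4 * j + 2) :=
      hsnd _ (mem_rowArcs.2 ⟨j, hj, .inl rfl⟩)
    have hr (j : ℕ) (hj : j ≤ q) : g (4 * j + 3) = f (4 * j + 3) :=
      hsnd _ (mem_rowArcs.2 ⟨j, hj, .inr rfl⟩)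
    simp only [G, doubleTwistCode, Code.weight_add, Code.weight_cons, Code.weight_singleton,
      Node.weight, Multiset.insert_eq_cons, weight_twists_congr k hsnd, hl 0 q.zero_le,
      hl q le_rfl, hr 0 q.zero_le, hr q le_rfl]
    ring
  rw [sumOver_congr hsplit, sumOver_rowArcs k (fun i j h => by lia) (fun i j h => by lia)
    (fun i j => by lia) p G]
  simp [G, delta, mul_comm]

theorem bracket_doubleTwist_eq_sum [Inhabited ι] (k : K) (p q : ℕ) :
    (doubleTwistCode p q).bracket ι k =
      ∑ a : ι, ∑ b, ∑ c, ∑ d,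
        resolve (twistCoeff ι k q) a b c d * resolve (twistCoeff ι k p) a d c b := by
  rw [Code.bracket, doubleTwist_arcs_dedup, sumOver_add, funext (sumOver_doubleTwist_fst k p q)]
  exact sumOver_rowArcs k (fun i j h => by lia) (fun i j h => by lia) (fun i j => by lia) q
    (fun a b c d => resolve (twistCoeff ι k p) a d c b) _

theorem bracket_doubleTwist_eq [Inhabited ι] (k : K) (p q : ℕ) :
    (doubleTwistCode p q).bracket ι k =
      Fintype.card ι + Fintype.card ι ^ 2 * (twistCoeff ι k p + twistCoeff ι k q) +
        Fintype.card ι * twistCoeff ι k p * twistCoeff ι k q := by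
  have hinner (a b : ι) : ∑ c, ∑ d,
      resolve (twistCoeff ι k q) a b c d * resolve (twistCoeff ι k p) a d c b =
        delta a b * ((twistCoeff ι k q * (twistCoeff ι k p + Fintype.card ι) + 1) * delta a b) +
          twistCoeff ι k p := by
    rw [sum_resolve_mul _ a b fun c d => resolve (twistCoeff ι k p) a d c b, sum_resolve_curl]
    simp only [resolve, delta_self]
    ring
  simp only [bracket_doubleTwist_eq_sum, hinner, Finset.sum_add_distrib, sum_delta_mul, delta_self,
    Finset.sum_const, Finset.card_univ, nsmul_eq_mul]
  ring

theorem card_mul_bracket_doubleTwist [Inhabited ι] (k : K) (p q : ℕ) :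
    Fintype.card ι * (doubleTwistCode p q).bracket ι k =
      ((k * Fintype.card ι + 1) ^ p + (Fintype.card ι ^ 2 - 1)) *
          ((k * Fintype.card ι + 1) ^ q + (Fintype.card ι ^ 2 - 1)) -
        Fintype.card ι ^ 2 * (Fintype.card ι ^ 2 - 1) := by
  rw [bracket_doubleTwist_eq, ← card_mul_twistCoeff_add_one k p, ← card_mul_twistCoeff_add_one k q]
  ring

end DoubleTwist

section Classification

theorem eq_and_eq_of_pow_add_mul_pow_add_eq {u c : ℝ} (hu : 0 < u) (hc : 0 < c)
    (huc : u * (2 * c + 1) ≤ c) {p q a b : ℕ} (hpq : p ≤ q) (hab : a ≤ b)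
    (h : (u ^ p + c) * (u ^ q + c) = (u ^ a + c) * (u ^ b + c)) : p = a ∧ q = b := by
  have hu1 : u < 1 := by nlinarith
  have fst_le {p q a b : ℕ} (hab : a ≤ b)
      (h : (u ^ p + c) * (u ^ q + c) = (u ^ a + c) * (u ^ b + c)) : a ≤ p := by
    by_contra! hpa
    have hba : u ^ b ≤ u ^ a := pow_le_pow_of_le_one hu.le hu1.le hab
    have hap : u ^ a ≤ u ^ p * u := by
      simpa only [pow_succ] using pow_le_pow_of_le_one hu.le hu1.le (Nat.succ_le_of_lt hpa)
    have ha1 : u ^ a ≤ 1 := pow_le_one₀ hu.le hu1.le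
    refine h.not_gt ?_
    calc (u ^ a + c) * (u ^ b + c)
      _ ≤ (u ^ a + c) * (u ^ a + c) := by gcongr
      _ = u ^ a * (u ^ a + 2 * c) + c * c := by ring
      _ ≤ u ^ p * u * (1 + 2 * c) + c * c := by gcongr
      _ = u ^ p * (u * (2 * c + 1)) + c * c := by ring
      _ ≤ u ^ p * c + c * c := by gcongr
      _ = (u ^ p + c) * c := by ring
      _ < (u ^ p + c) * (u ^ q + c) := by gcongr; exact lt_add_of_pos_left c (by positivity)
  obtain rfl : p = a := le_antisymm (fst_le hpq h.symm) (fst_le hab h)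
  have hqb : u ^ q = u ^ b := add_right_cancel (mul_left_cancel₀ (by positivity) h)
  exact ⟨rfl, pow_right_injective₀ hu hu1.ne hqb⟩

theorem eq_or_eq_swap_of_pow_add_mul_pow_add_eq {u c : ℝ} (hu : 0 < u) (hc : 0 < c)
    (huc : u * (2 * c + 1) ≤ c) {p q a b : ℕ}
    (h : (u ^ p + c) * (u ^ q + c) = (u ^ a + c) * (u ^ b + c)) :
    p = a ∧ q = b ∨ p = b ∧ q = a := by
  wlog hpq : p ≤ q generalizing p q
  · have := this (mul_comm (u ^ q + c) _ ▸ h) (by lia)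
    lia
  rcases le_total a b with hab | hab
  · exact .inl (eq_and_eq_of_pow_add_mul_pow_add_eq hu hc huc hpq hab h)
  · exact .inr (eq_and_eq_of_pow_add_mul_pow_add_eq hu hc huc hpq hab (mul_comm (u ^ a + c) _ ▸ h))

theorem eq_one_of_mem_signedPowers {k w : ℝˣ} (hk : |(k : ℝ)| < 1 / 2) (hw : w ∈ signedPowers k)
    (hw1 : 1 / 2 < (w : ℝ)) (hw2 : (w : ℝ) < 2) : w = 1 := by
  obtain ⟨m, n, rfl⟩ := Subgroup.mem_closure_pair.1 hw
  have hk0 : 0 < |(k : ℝ)| := abs_pos.2 k.ne_zero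
  have hkn : |(((-1) ^ m * k ^ n : ℝˣ) : ℝ)| = |(k : ℝ)| ^ n := by simp [abs_mul, abs_zpow]
  rw [abs_of_pos (by linarith)] at hkn
  rw [hkn] at hw1 hw2
  have hn0 : n = 0 := by
    refine le_antisymm (not_lt.1 fun hn => hw1.not_gt ?_) (not_lt.1 fun hn => hw2.not_gt ?_)
    · calc |(k : ℝ)| ^ n
        _ ≤ |(k : ℝ)| ^ (1 : ℤ) := zpow_le_zpow_right_of_le_one₀ hk0 (by linarith) hn
        _ < 1 / 2 := by rwa [zpow_one]
    · calc (2 : ℝ)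
        _ < |(k : ℝ)| ^ (-1 : ℤ) := by rw [zpow_neg_one, lt_inv_comm₀ two_pos hk0]; linarith
        _ ≤ |(k : ℝ)| ^ n := zpow_le_zpow_right_of_le_one₀ hk0 (by linarith) (by lia)
  subst hn0
  rcases m.even_or_odd with hm | hm
  · simp [hm.neg_one_zpow]
  · rw [hm.neg_one_zpow] at hkn
    norm_num at hkn

theorem exists_unit_add_inv_add_three_eq_zero :
    ∃ k : ℝˣ, (k + ↑k⁻¹ + 3 : ℝ) = 0 ∧ |(k : ℝ)| < 2 / 5 := by
  have h5 : √5 ^ 2 = 5 := Real.sq_sqrt (by norm_num)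
  refine ⟨⟨(√5 - 3) / 2, -(√5 + 3) / 2, by linarith, by linarith⟩, ?_, ?_⟩
  · rw [Units.inv_mk]
    ring
  · rw [abs_lt]
    constructor <;> nlinarith [Real.sqrt_nonneg 5]

theorem three_mul_bracket_doubleTwist {k : ℝˣ} (hk : (k + ↑k⁻¹ + 3 : ℝ) = 0) {p q : ℕ}
    (hp : Even p) (hq : Even q) :
    3 * (doubleTwistCode p q).bracket (Fin 3) (k : ℝ) =
      (((k : ℝ) ^ 2) ^ p + 8) * (((k : ℝ) ^ 2) ^ q + 8) - 72 := by
  have hbase : (k * 3 + 1 : ℝ) = -(k : ℝ) ^ 2 := by linear_combination (k : ℝ) * hk - k.mul_inv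
  have h := card_mul_bracket_doubleTwist (ι := Fin 3) (k : ℝ) p q
  rw [Fintype.card_fin, Nat.cast_ofNat, hbase, hp.neg_pow, hq.neg_pow] at h
  linarith

theorem bracket_doubleTwist_mem_Ioo {k : ℝˣ} (hk : (k + ↑k⁻¹ + 3 : ℝ) = 0)
    (hk' : (k : ℝ) ^ 2 < 1 / 5) {p q : ℕ} (hp : Even p) (hq : Even q) (p_pos : 0 < p)
    (q_pos : 0 < q) :
    3 * (doubleTwistCode p q).bracket (Fin 3) (k : ℝ) ∈ Set.Ioo (-8) (-4) := by
  have hk0 : 0 < (k : ℝ) ^ 2 := sq_pos_of_ne_zero k.ne_zero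
  have hpow {n : ℕ} (hn : 0 < n) : ((k : ℝ) ^ 2) ^ n < 1 / 5 :=
    (pow_le_of_le_one hk0.le (by linarith) hn.ne').trans_lt hk'
  have hp0 := pow_pos hk0 p
  have hq0 := pow_pos hk0 q
  rw [three_mul_bracket_doubleTwist hk hp hq]
  constructor <;> nlinarith [hpow p_pos, hpow q_pos]

theorem bracket_eq_of_doubleTwistKnot_eq {k : ℝˣ} (hk : (k + ↑k⁻¹ + 3 : ℝ) = 0)
    (hk' : |(k : ℝ)| < 2 / 5) {p q a b : ℕ} {hp : Even p} {hq : Even q} {ha : Even a}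
    {hb : Even b} (p_pos : 0 < p) (q_pos : 0 < q) (a_pos : 0 < a) (b_pos : 0 < b)
    (h : doubleTwistKnot p q hp hq = doubleTwistKnot a b ha hb) :
    (doubleTwistCode p q).bracket (Fin 3) (k : ℝ) =
      (doubleTwistCode a b).bracket (Fin 3) (k : ℝ) := by
  have hsq : (k : ℝ) ^ 2 < 1 / 5 := by nlinarith [sq_abs (k : ℝ), abs_nonneg (k : ℝ)]
  obtain ⟨w, hw, hpqab⟩ := exists_bracket_eq_of_mk_eq (k := k) (ι := Fin 3) (by simpa using hk) h
  obtain ⟨hpq8, hpq4⟩ := bracket_doubleTwist_mem_Ioo hk hsq hp hq p_pos q_pos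
  obtain ⟨hab8, hab4⟩ := bracket_doubleTwist_mem_Ioo hk hsq ha hb a_pos b_pos
  change (doubleTwistCode p q).bracket (Fin 3) (k : ℝ) =
    w * (doubleTwistCode a b).bracket (Fin 3) (k : ℝ) at hpqab
  obtain rfl : w = 1 := by
    refine eq_one_of_mem_signedPowers (by linarith) hw ?_ ?_ <;> by_contra! hw' <;> nlinarith
  simpa using hpqab

theorem eq_or_eq_swap_of_doubleTwistKnot_eq {p q a b : ℕ} {hp : Even p} {hq : Even q} {ha : Even a}
    {hb : Even b} (p_pos : 0 < p) (q_pos : 0 < q) (a_pos : 0 < a) (b_pos : 0 < b)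
    (h : doubleTwistKnot p q hp hq = doubleTwistKnot a b ha hb) :
    p = a ∧ q = b ∨ p = b ∧ q = a := by
  obtain ⟨k, hk, hk'⟩ := exists_unit_add_inv_add_three_eq_zero
  have hprod := congrArg (3 * ·) (bracket_eq_of_doubleTwistKnot_eq hk hk' p_pos q_pos a_pos b_pos h)
  simp only [three_mul_bracket_doubleTwist hk, hp, hq, ha, hb, sub_left_inj] at hprod
  have hsq0 : 0 < (k : ℝ) ^ 2 := sq_pos_of_ne_zero k.ne_zero
  have hsq : (k : ℝ) ^ 2 * (2 * 8 + 1) ≤ 8 := by nlinarith [sq_abs (k : ℝ), abs_nonneg (k : ℝ)]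
  exact eq_or_eq_swap_of_pow_add_mul_pow_add_eq hsq0 (by norm_num) hsq hprod

theorem relabel_twists (σ l r : ℕ → ℕ) (n : ℕ) :
    (twists l r n).map (Node.relabel σ) = twists (σ ∘ l) (σ ∘ r) n := by
  simp only [twists, Multiset.map_map]
  rfl

theorem doubleTwistKnot_comm (p q : ℕ) (hp : Even p) (hq : Even q) :
    doubleTwistKnot p q hp hq = doubleTwistKnot q p hq hp := by
  have hσ : Function.Involutive fun x : ℕ => if x % 4 < 2 then x + 2 else x - 2 := fun x => by
    dsimp only
    grind
  refine Quot.sound (Move.rename (hσ.toPerm _) ?_)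
  have h₀ (i : ℕ) : hσ.toPerm _ (4 * i) = 4 * i + 2 := if_pos (by lia)
  have h₁ (i : ℕ) : hσ.toPerm _ (4 * i + 1) = 4 * i + 3 := if_pos (by lia)
  have h₂ (i : ℕ) : hσ.toPerm _ (4 * i + 2) = 4 * i := if_neg (by lia)
  have h₃ (i : ℕ) : hσ.toPerm _ (4 * i + 3) = 4 * i + 1 := if_neg (by lia)
  change Multiset.Rel Node.Same ((doubleTwistCode p q).map _) (doubleTwistCode q p)
  simp only [doubleTwistCode, Multiset.map_add, relabel_twists, Function.comp_def,
    Multiset.insert_eq_cons, Multiset.map_cons, Multiset.map_singleton, Node.relabel, h₀, h₁, h₂,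
    h₃]
  rw [add_comm (twists _ _ q) (twists _ _ p)]
  refine .add (Multiset.rel_refl_of_refl_on fun v _ => .refl v) (.cons (.swap _ _) ?_)
  rw [Multiset.cons_swap]
  exact .cons (.swap _ _) (.cons (.swap _ _) (.cons (.swap _ _) .zero))

end Classification

end KnotDiag

theorem theorem3p11 (p q a b : ℕ) (hp : Even p) (hq : Even q) (ha : Even a) (hb : Even b)
    (p_pos : 0 < p) (q_pos : 0 < q) (a_pos : 0 < a) (b_pos : 0 < b) :
    KnotDiag.doubleTwistKnot p q hp hq = KnotDiag.doubleTwistKnot a b ha hb ↔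
      ({p, q} : Set ℕ) = {a, b} := by
  rw [Set.pair_eq_pair_iff]
  refine ⟨KnotDiag.eq_or_eq_swap_of_doubleTwistKnot_eq p_pos q_pos a_pos b_pos, ?_⟩
  rintro (⟨rfl, rfl⟩ | ⟨rfl, rfl⟩)
  · rfl
  · exact KnotDiag.doubleTwistKnot_comm _ _ _ _
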